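/- Let $\mathbb{Z}^{\infty}=\bigoplus_{n=1}^{\infty}\mathbb{Z}$. For an action $(T^g)_{g\in\mathbb{Z}^\infty}$ on a measure space $(X,\mathcal{B},\mu)$, a finite set $F\subseteq\mathbb{Z}^\infty$ and functions $\varphi,\psi:X\to\mathbb{R}$, write $$S_F(\varphi)=\sum_{g\in F}\varphi\circ T^g,\qquad R_F(\varphi,\psi)=\frac{S_F(\varphi)}{S_F(\psi)} .$$ The ratio ergodic theorem fails for $\mathbb{Z}^\infty$ along every sequence of finite sets. That is, for every sequence $(F_n)_{n\ge 1}$ of finite subsets of $\mathbb{Z}^{\infty}$ there exist an ergodic measure-preserving action of $\mathbb{Z}^{\infty}$ on a non-atomic, $\sigma$-finite, infinite measure space $(X,\mathcal{B},\mu)$, with $(X,\mathcal{B})$ a standard Borel space, and functions $\varphi,\psi\in L^1(\mu)$ with $\int\psi\,d\mu\neq 0$, such that it is not the case that $$R_{F_n}(\varphi,\psi)\longrightarrow\frac{\int\varphi\,d\mu}{\int\psi\,d\mu}\qquad \mu\text{-a.e. as } n\to\infty .$$ (Here a quotient with denominator $0$ is given the value $0$.) -/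

import Mathlib

open MeasureTheory Filter Topology

/-- The group `ℤ^∞ = ⊕ ℤ` (countably many copies of `ℤ`): the finitely supported integer
sequences. -/
abbrev ZInfty : Type := ℕ →₀ ℤ

/-- The sum `S_F(φ)(x) = ∑_{g ∈ F} φ(T^g x)` over a finite set `F` of group elements; the action
`T^g x` of the (additively written) group `G` is `g +ᵥ x`. -/
noncomputable def ergodicSum {G X : Type*} [VAdd G X] (F : Finset G) (φ : X → ℝ) (x : X) : ℝ :=
  ∑ g ∈ F, φ (g +ᵥ x)

/-- The ratio `R_F(φ, ψ)(x) = S_F(φ)(x) / S_F(ψ)(x)`. -/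
noncomputable def ergodicRatio {G X : Type*} [VAdd G X] (F : Finset G) (φ ψ : X → ℝ) (x : X) : ℝ :=
  ergodicSum F φ x / ergodicSum F ψ x

/-- The ratio ergodic theorem holds for the additive group `G` along the sequence `F` of finite
subsets of `G`: for every ergodic measure-preserving action of `G` on a non-atomic `σ`-finite
infinite measure space (with underlying standard Borel space, where "non-atomic" is the same as
"points are null"), and for all `φ, ψ ∈ L¹(μ)` with `∫ ψ ≠ 0`, the ratios `R_{F n}(φ, ψ)` converge
to `∫ φ / ∫ ψ` almost everywhere.

The convention `a / 0 = 0` is harmless here: the case `φ = ψ` forces, for almost every `x`,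
the denominators `S_{F n}(ψ)(x)` to be nonzero for all large `n`. -/
def RatioErgodicTheoremAlong {G : Type*} [AddGroup G] (F : ℕ → Finset G) : Prop :=
  ∀ (X : Type) [MeasurableSpace X] [StandardBorelSpace X]
    [AddAction G X] [MeasurableConstVAdd G X]
    (μ : Measure X) [SigmaFinite μ] [NullSingletonClass μ] [ErgodicVAdd G X μ],
    μ Set.univ = ⊤ →
    ∀ φ ψ : X → ℝ, Integrable φ μ → Integrable ψ μ → ∫ x, ψ x ∂μ ≠ 0 →
      ∀ᵐ x ∂μ, Tendsto (fun n => ergodicRatio (F n) φ ψ x) atTop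
        (𝓝 ((∫ y, φ y ∂μ) / ∫ y, ψ y ∂μ))

/-!
The ratio ergodic theorem fails because every sequence `F n` that is not eventually contained in a
fixed `ℤ^d` violates the Besicovitch covering property. If the `F n` are eventually contained in
`ℤ^d`, then they act trivially in an action of the quotient of `ℤ^∞` by `ℤ^d`, and the ratios are
`φ / ψ` (or `0`), independently of `n` (`not_ratioErgodicTheoremAlong_of_supportedBelow`).

Otherwise, `Escaping.exists_separated` provides, for any number `N`, any finite `E ⊆ ℤ^d` and
arbitrarily large indices `n i`, elements `h i ∈ F (n i)`, `i < N`, such that `h i - h j` lies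
neither in `F (n i) + E` nor in `ℤ^d` for `i ≠ j`. Each `h i` uses a coordinate beyond those of the
earlier sets, which keeps the earlier sets away from `h j - h i`; being extremal in `F (n i)` for a
functional that is positive on the earlier `h j + e`, it also satisfies `h i - h j - e ∉ F (n i)`.

These elements, taken anew in each stage `k` and with `N k` much larger than the finite set `P k` of
positions created before, define an action of cutting-and-stacking type: in stage `k` the base is cut into
`N k` pieces, and the `i`-th piece is placed at `-h k i`. Concretely, the space is the quotient of
`∏ ℤ / N k × ℤ^∞` by the tail equivalence relation twisted by the cocycle of positions, with
`ℤ^∞` acting by translation on the second factor. The quotient is taken on a measurable transversal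
(`OrbitNumbering`); ergodicity comes down to that of the dense subgroup of finitely supported digit
sequences acting on the compact group `∏ ℤ / N k`.

Let `ψ` be the indicator of the base, and let `φ` carry the weight `2 ^ k * |P k|` on the set that
is reached from the base by moving each digit sequence `ω` by `h k (ω k)`; this set has measure
`1 / N k`, so `φ` is integrable. For a point `ω` of the base and `n = n k (ω k)`, the numerator is
at least `2 ^ k * |P k|`, since `h k (ω k) ∈ F n` leads into that set. By separation, `F n` returns
`ω` to the base only through changes of digits before stage `k`, so the denominator is at most
`|P k|`. If the theorem held, the denominators would be nonzero for large `n` (this is the case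
`φ = ψ`), and the ratios would then be unbounded at almost every point of the base.
-/

/-! ### Separated elements of escaping finite sets -/

/-- Every coordinate of `g` from index `d` on vanishes: `g` lies in the copy of `ℤ^d` spanned by
the first `d` basis vectors. -/
def SupportedBelow (d : ℕ) (g : ZInfty) : Prop := ∀ m, d ≤ m → g m = 0

namespace SupportedBelow

variable {d d' : ℕ} {g g' : ZInfty}

lemma mono (h : SupportedBelow d g) (hd : d ≤ d') : SupportedBelow d' g :=
  fun m hm => h m (hd.trans hm)

lemma zero (d : ℕ) : SupportedBelow d 0 := fun _ _ => rfl

lemma sub (h : SupportedBelow d g) (h' : SupportedBelow d g') : SupportedBelow d (g - g') :=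
  fun m hm => by simp [h m hm, h' m hm]

end SupportedBelow

lemma exists_supportedBelow (s : Finset ZInfty) : ∃ d, ∀ g ∈ s, SupportedBelow d g := by
  refine ⟨s.sup (fun g => g.support.sup id + 1), fun g hg m hm => ?_⟩
  by_contra hne
  have h1 : m ≤ g.support.sup id := Finset.le_sup (f := id) (Finsupp.mem_support_iff.2 hne)
  have h2 : g.support.sup id + 1 ≤ _ :=
    Finset.le_sup (f := fun g : ZInfty => g.support.sup id + 1) hg
  omega

/-- For every `d` there are arbitrarily large `n` for which `F n` is not contained in `ℤ^d`. -/
def Escaping (F : ℕ → Finset ZInfty) : Prop :=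
  ∀ d n₀, ∃ n, n₀ ≤ n ∧ ∃ g ∈ F n, ¬ SupportedBelow d g

/-- The inductive form of `Escaping.exists_separated`. The additional datum is a homomorphism `L`
that is positive on all `h j + e`: if the next element is chosen to minimise `L` among the elements
of its set lying outside the span of everything used so far, then subtracting `h j + e` from it
leads out of that set. -/
lemma Escaping.exists_separated_aux {F : ℕ → Finset ZInfty} (hF : Escaping F) (d : ℕ)
    (E : Finset ZInfty) (hE : ∀ e ∈ E, SupportedBelow d e) (n₀ N : ℕ) :
    ∃ (L : ZInfty →+ ℤ) (n : ℕ → ℕ) (h : ℕ → ZInfty),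
      (∀ i < N, n₀ ≤ n i ∧ h i ∈ F (n i) ∧ ∀ e ∈ E, 0 < L (h i + e)) ∧
      ∀ i < N, ∀ j < i, ¬ SupportedBelow d (h i - h j) ∧
        ∀ e ∈ E, h i - h j - e ∉ F (n i) ∧ h j - h i - e ∉ F (n j) := by
  induction N with
  | zero => exact ⟨0, fun _ => 0, fun _ => 0, by simp, by simp⟩
  | succ N ih =>
    obtain ⟨L, n, h, h1, h2⟩ := ih
    obtain ⟨d₁, hd₁⟩ := exists_supportedBelow ((Finset.range N).biUnion fun i => F (n i))
    obtain ⟨n', hn', g₀, hg₀, hg₀'⟩ := hF (max d d₁) n₀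
    classical
    obtain ⟨g, hg, hmin⟩ := Finset.exists_min_image
      ((F n').filter fun g => ¬ SupportedBelow (max d d₁) g) L ⟨g₀, by simp [hg₀, hg₀']⟩
    simp only [Finset.mem_filter, and_imp] at hg hmin
    obtain ⟨hgF, hgd⟩ := hg
    obtain ⟨m, hm, hgm⟩ : ∃ m, max d d₁ ≤ m ∧ g m ≠ 0 := by
      by_contra! hcon
      exact hgd hcon
    have hdm : d ≤ m := (le_max_left _ _).trans hm
    have hFm : ∀ j < N, ∀ x ∈ F (n j), x m = 0 := fun j hj x hx =>
      hd₁ x (Finset.mem_biUnion.2 ⟨j, Finset.mem_range.2 hj, hx⟩) m ((le_max_right _ _).trans hm)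
    have hhm : ∀ j < N, h j m = 0 := fun j hj => hFm j hj _ (h1 j hj).2.1
    have hEm : ∀ e ∈ E, e m = 0 := fun e he => hE e he m hdm
    -- The coordinate `m` occurs in `g` only, so adding a multiple of it to `L` makes `L (g + e)`
    -- positive without affecting the earlier values.
    obtain ⟨T, hT⟩ : ∃ T : ℤ, 0 ≤ T ∧ ∀ e ∈ E, 0 < L (g + e) + T := by
      refine ⟨∑ e ∈ E, |L (g + e)| + 1, by positivity, fun e he => ?_⟩
      have := Finset.single_le_sum (f := fun e => |L (g + e)|) (fun _ _ => abs_nonneg _) he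
      have := neg_abs_le (L (g + e))
      linarith
    refine ⟨L + (g m * T) • Finsupp.applyAddHom m, fun i => if i < N then n i else n',
      fun i => if i < N then h i else g, ?_, ?_⟩
    · intro i hi
      rcases Nat.lt_succ_iff_lt_or_eq.1 hi with hi | rfl
      · simp only [hi, if_true]
        refine ⟨(h1 i hi).1, (h1 i hi).2.1, fun e he => ?_⟩
        simpa [hhm i hi, hEm e he] using (h1 i hi).2.2 e he
      · simp only [lt_irrefl, if_false]
        refine ⟨hn', hgF, fun e he => ?_⟩
        have h3 := hT.2 e he
        have h4 : 1 ≤ g m * g m := by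
          have := mul_self_pos.2 hgm
          omega
        have h5 : T ≤ g m * T * g m := by nlinarith [hT.1]
        have : (L + (g m * T) • (Finsupp.applyAddHom m : ZInfty →+ ℤ)) (g + e) =
            L (g + e) + g m * T * g m := by
          simp [hEm e he]
        rw [this]
        omega
    · intro i hi j hj
      rcases Nat.lt_succ_iff_lt_or_eq.1 hi with hi | rfl
      · simpa only [hi, hj.trans hi, if_true] using h2 i hi j hj
      · simp only [lt_irrefl, if_false, hj, if_true]
        refine ⟨fun hs => hgm (by simpa [hhm j hj] using hs m hdm), fun e he => ⟨fun hmem => ?_,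
          fun hmem => hgm (by simpa [hhm j hj, hEm e he] using hFm j hj _ hmem)⟩⟩
        have h3 := hmin _ hmem fun hs => hgm (by simpa [hhm j hj, hEm e he] using hs m hm)
        have h4 := (h1 j hj).2.2 e he
        rw [sub_sub, map_sub] at h3
        omega

/-- Failure of the Besicovitch property: any number of elements `h i ∈ F (n i)` can be found whose
differences `h i - h j` stay away from `F (n i)` (up to an error in `E`) and from `ℤ^d`. -/
lemma Escaping.exists_separated {F : ℕ → Finset ZInfty} (hF : Escaping F) (d : ℕ)
    (E : Finset ZInfty) (hE : ∀ e ∈ E, SupportedBelow d e) (n₀ N : ℕ) :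
    ∃ (n : ℕ → ℕ) (h : ℕ → ZInfty),
      (∀ i < N, n₀ ≤ n i ∧ h i ∈ F (n i)) ∧
      ∀ i < N, ∀ j < N, i ≠ j → ¬ SupportedBelow d (h i - h j) ∧
        ∀ e ∈ E, h i - h j - e ∉ F (n i) := by
  obtain ⟨_, n, h, h1, h2⟩ := hF.exists_separated_aux d E hE n₀ N
  refine ⟨n, h, fun i hi => ⟨(h1 i hi).1, (h1 i hi).2.1⟩, fun i hi j hj hij => ?_⟩
  rcases lt_or_gt_of_ne hij with hlt | hlt
  · refine ⟨fun hs => (h2 j hj i hlt).1 ?_, fun e he => ((h2 j hj i hlt).2 e he).2⟩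
    simpa using (SupportedBelow.zero d).sub hs
  · exact ⟨(h2 i hi j hlt).1, fun e he => ((h2 i hi j hlt).2 e he).1⟩

/-- The parameters of the construction of an action of `ℤ^∞` in stages. At stage `k` there are
`N k` vectors `h k i`, one for each digit `i`. -/
structure Stages where
  /-- The number of digits at stage `k`, which outweighs the number of positions `P k`. -/
  N : ℕ → ℕ
  /-- The vectors attached to the digits of stage `k`. -/
  h : ∀ k, Fin (N k) → ZInfty
  /-- The earlier stages live in `ℤ ^ d k`. -/
  d : ℕ → ℕ
  /-- The possible positions after the first `k` stages. -/
  P : ℕ → Finset ZInfty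
  N_pos : ∀ k, NeZero (N k)
  d_zero : d 0 = 1
  d_mono : Monotone d
  card_le : ∀ k, 4 ^ k * (P k).card ≤ N k
  P_zero : 0 ∈ P 0
  P_sub : ∀ k, ∀ p ∈ P k, ∀ i, p - h k i ∈ P (k + 1)
  P_below : ∀ k, ∀ p ∈ P k, SupportedBelow (d k) p
  /-- Differences of vectors of stage `k` leave the span of the earlier stages. -/
  h_sub : ∀ k i j, i ≠ j → ¬ SupportedBelow (d k) (h k i - h k j)

/-- The stages `S` are adapted to the sets `F`: the vectors `h k i` witness the failure of the
Besicovitch property for the set `F (n k i)`, up to errors from the earlier stages. -/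
structure Stages.Adapted (S : Stages) (F : ℕ → Finset ZInfty) (n : ∀ k, Fin (S.N k) → ℕ) :
    Prop where
  le : ∀ k i, k ≤ n k i
  mem : ∀ k i, S.h k i ∈ F (n k i)
  below : ∀ k i, ∀ g ∈ F (n k i), SupportedBelow (S.d (k + 1)) g
  notMem : ∀ k i j, i ≠ j → ∀ p ∈ S.P k, ∀ q ∈ S.P k, S.h k i - S.h k j - (p - q) ∉ F (n k i)

open scoped Pointwise in
lemma Escaping.exists_stages {F : ℕ → Finset ZInfty} (hF : Escaping F) :
    ∃ (S : Stages) (n : ∀ k, Fin (S.N k) → ℕ), S.Adapted F n := by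
  classical
  -- One step: from `(d, P)` to the data of stage `k` and the next `d`.
  have step : ∀ (k : ℕ) (s : ℕ × Finset ZInfty), ∃ (n : ℕ → ℕ) (h : ℕ → ZInfty) (d' : ℕ),
      (∀ p ∈ s.2, SupportedBelow s.1 p) →
      (∀ i < 4 ^ k * s.2.card, k ≤ n i ∧ h i ∈ F (n i) ∧
        ∀ g ∈ F (n i), SupportedBelow d' g) ∧ s.1 ≤ d' ∧
      ∀ i < 4 ^ k * s.2.card, ∀ j < 4 ^ k * s.2.card, i ≠ j →
        ¬ SupportedBelow s.1 (h i - h j) ∧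
        ∀ p ∈ s.2, ∀ q ∈ s.2, h i - h j - (p - q) ∉ F (n i) := by
    intro k s
    by_cases hs : ∀ p ∈ s.2, SupportedBelow s.1 p
    · obtain ⟨n, h, h1, h2⟩ := hF.exists_separated s.1 (s.2 - s.2) (fun e he => by
        obtain ⟨p, hp, q, hq, rfl⟩ := Finset.mem_sub.1 he
        exact (hs p hp).sub (hs q hq)) k (4 ^ k * s.2.card)
      obtain ⟨d', hd'⟩ := exists_supportedBelow
        ((Finset.range (4 ^ k * s.2.card)).biUnion fun i => F (n i))
      refine ⟨n, h, max s.1 d', fun _ => ⟨fun i hi => ⟨(h1 i hi).1, (h1 i hi).2, fun g hg =>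
        (hd' g (Finset.mem_biUnion.2 ⟨i, Finset.mem_range.2 hi, hg⟩)).mono (le_max_right _ _)⟩,
        le_max_left _ _, fun i hi j hj hij => ⟨(h2 i hi j hj hij).1, fun p hp q hq =>
        (h2 i hi j hj hij).2 _ (Finset.sub_mem_sub hp hq)⟩⟩⟩
    · exact ⟨fun _ => 0, fun _ => 0, 0, fun h => absurd h hs⟩
  choose n h d' hstep using step
  let s : ℕ → ℕ × Finset ZInfty := fun k => Nat.rec (1, {0})
    (fun k s => (d' k s, s.2 - (Finset.range (4 ^ k * s.2.card)).image (h k s))) k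
  have hs_succ : ∀ k, s (k + 1) = (d' k (s k),
    (s k).2 - (Finset.range (4 ^ k * (s k).2.card)).image (h k (s k))) := fun k => rfl
  have hne : ∀ k, (s k).2.Nonempty := by
    intro k
    induction k with
    | zero => exact ⟨0, Finset.mem_singleton_self 0⟩
    | succ k ih =>
      rw [hs_succ]
      refine ih.sub (Finset.image_nonempty.2 ?_)
      have := ih.card_pos
      exact Finset.nonempty_range_iff.2 (by positivity)
  have hgood : ∀ k, ∀ p ∈ (s k).2, SupportedBelow (s k).1 p := by
    intro k
    induction k with
    | zero =>
      intro p hp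
      rw [Finset.mem_singleton.1 hp]
      exact SupportedBelow.zero _
    | succ k ih =>
      rw [hs_succ]
      intro p hp
      obtain ⟨q, hq, r, hr, rfl⟩ := Finset.mem_sub.1 hp
      obtain ⟨i, hi, rfl⟩ := Finset.mem_image.1 hr
      obtain ⟨h1, h2, -⟩ := hstep k (s k) ih
      have h3 := h1 i (Finset.mem_range.1 hi)
      exact ((ih q hq).mono h2).sub (h3.2.2 _ h3.2.1)
  have key := fun k => hstep k (s k) (hgood k)
  refine ⟨{ N := fun k => 4 ^ k * (s k).2.card
            h := fun k i => h k (s k) i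
            d := fun k => (s k).1
            P := fun k => (s k).2
            N_pos := fun k => ⟨by have := (hne k).card_pos; positivity⟩
            d_zero := rfl
            d_mono := monotone_nat_of_le_succ fun k => (key k).2.1
            card_le := fun k => le_rfl
            P_zero := Finset.mem_singleton_self 0
            P_sub := fun k p hp i => Finset.sub_mem_sub hp
              (Finset.mem_image_of_mem _ (Finset.mem_range.2 i.2))
            P_below := hgood
            h_sub := fun k i j hij => ((key k).2.2 i i.2 j j.2 (Fin.val_ne_of_ne hij)).1 },
    fun k i => n k (s k) i, ?_⟩
  exact
    { le := fun k i => ((key k).1 i i.2).1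
      mem := fun k i => ((key k).1 i i.2).2.1
      below := fun k i => ((key k).1 i i.2).2.2
      notMem := fun k i j hij => ((key k).2.2 i i.2 j j.2 (Fin.val_ne_of_ne hij)).2 }

/-! ### Quotients of measure spaces by smooth actions of countable groups -/

/-- A measurable numbering of `Z` that separates the points of every `Γ`-orbit and witnesses that
`Γ` acts freely. Choosing the point of least number in each orbit yields a measurable
transversal. -/
structure OrbitNumbering (Γ Z : Type) [AddGroup Γ] [AddAction Γ Z] [MeasurableSpace Z] where
  /-- The number of a point. -/
  num : Z → ℕ
  measurable_num : Measurable num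
  eq_zero_of_num_eq : ∀ (γ : Γ) z, num (γ +ᵥ z) = num z → γ = 0

namespace OrbitNumbering

open scoped Pointwise

variable {Γ Z : Type} [AddGroup Γ] [AddAction Γ Z] [MeasurableSpace Z] (s : OrbitNumbering Γ Z)

/-- The points whose number is least in their orbit. -/
def transversal : Set Z := {z | ∀ γ : Γ, s.num z ≤ s.num (γ +ᵥ z)}

/-- The quotient `Z / Γ`, realised as the subspace `s.transversal` of `Z`. -/
def Space : Type := s.transversal

instance : MeasurableSpace s.Space := inferInstanceAs (MeasurableSpace s.transversal)

lemma existsUnique_vadd_mem (z : Z) : ∃! γ : Γ, γ +ᵥ z ∈ s.transversal := by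
  classical
  have hex : ∃ n, ∃ γ : Γ, s.num (γ +ᵥ z) = n := ⟨_, 0, rfl⟩
  obtain ⟨γ, hγ⟩ := Nat.find_spec hex
  refine ⟨γ, fun δ => ?_, fun δ hδ => ?_⟩
  · rw [hγ, vadd_vadd]
    exact Nat.find_min' hex ⟨_, rfl⟩
  · have h1 := hδ (γ - δ)
    rw [vadd_vadd, sub_add_cancel] at h1
    have h2 : s.num (γ +ᵥ z) ≤ s.num (δ +ᵥ z) := by
      rw [hγ]
      exact Nat.find_min' hex ⟨_, rfl⟩
    refine sub_eq_zero.1 (s.eq_zero_of_num_eq (δ - γ) (γ +ᵥ z) ?_)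
    rw [vadd_vadd, sub_add_cancel]
    exact le_antisymm h1 h2

/-- The quotient map `Z → Z / Γ`. -/
noncomputable def proj (z : Z) : s.Space :=
  ⟨(s.existsUnique_vadd_mem z).choose +ᵥ z, (s.existsUnique_vadd_mem z).choose_spec.1⟩

/-- The inclusion of the transversal into `Z`. -/
def lift (x : s.Space) : Z := x.1

lemma exists_vadd_eq_lift_proj (z : Z) : ∃ γ : Γ, γ +ᵥ z = s.lift (s.proj z) :=
  ⟨(s.existsUnique_vadd_mem z).choose, rfl⟩

lemma lift_mem (x : s.Space) : s.lift x ∈ s.transversal := x.2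

lemma lift_injective : Function.Injective s.lift := Subtype.val_injective

lemma proj_eq_of_vadd_eq_lift {γ : Γ} {z : Z} {x : s.Space} (h : γ +ᵥ z = s.lift x) :
    s.proj z = x := by
  apply s.lift_injective
  obtain ⟨δ, hδ⟩ := s.exists_vadd_eq_lift_proj z
  have h1 : δ +ᵥ z ∈ s.transversal := hδ ▸ s.lift_mem _
  have h2 : γ +ᵥ z ∈ s.transversal := h ▸ s.lift_mem _
  rw [← hδ, ← h, (s.existsUnique_vadd_mem z).unique h1 h2]

@[simp] lemma proj_lift (x : s.Space) : s.proj (s.lift x) = x :=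
  s.proj_eq_of_vadd_eq_lift (zero_vadd Γ _)

@[simp] lemma proj_vadd (γ : Γ) (z : Z) : s.proj (γ +ᵥ z) = s.proj z := by
  obtain ⟨δ, hδ⟩ := s.exists_vadd_eq_lift_proj (γ +ᵥ z)
  rw [vadd_vadd] at hδ
  exact (s.proj_eq_of_vadd_eq_lift hδ).symm

lemma proj_eq_proj_iff {z w : Z} : s.proj z = s.proj w ↔ ∃ γ : Γ, γ +ᵥ z = w := by
  refine ⟨fun h => ?_, ?_⟩
  · obtain ⟨γ, hγ⟩ := s.exists_vadd_eq_lift_proj z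
    obtain ⟨δ, hδ⟩ := s.exists_vadd_eq_lift_proj w
    refine ⟨-δ + γ, ?_⟩
    rw [← vadd_vadd, hγ, h, ← hδ, neg_vadd_vadd]
  · rintro ⟨γ, rfl⟩
    simp

lemma preimage_vadd_preimage_proj (γ : Γ) (A : Set s.Space) :
    (fun z => γ +ᵥ z) ⁻¹' (s.proj ⁻¹' A) = s.proj ⁻¹' A := by
  ext z
  simp

lemma lift_image_eq (A : Set s.Space) : s.lift '' A = s.proj ⁻¹' A ∩ s.transversal := by
  ext z
  constructor
  · rintro ⟨x, hx, rfl⟩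
    exact ⟨by simpa using hx, s.lift_mem x⟩
  · rintro ⟨h1, h2⟩
    exact ⟨s.proj z, h1,
      congrArg s.lift (s.proj_eq_of_vadd_eq_lift (x := ⟨z, h2⟩) (zero_vadd Γ z))⟩

section Action

variable {G : Type} [AddGroup G] [AddAction G Z] [VAddCommClass G Γ Z]

/-- An action on `Z` commuting with that of `Γ` descends to `Z / Γ`. -/
noncomputable instance : VAdd G s.Space := ⟨fun a x => s.proj (a +ᵥ s.lift x)⟩

lemma vadd_proj (a : G) (z : Z) : a +ᵥ s.proj z = s.proj (a +ᵥ z) := by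
  obtain ⟨γ, hγ⟩ := s.exists_vadd_eq_lift_proj z
  change s.proj (a +ᵥ s.lift (s.proj z)) = _
  rw [← hγ, vadd_comm, proj_vadd]

noncomputable instance : AddAction G s.Space where
  zero_vadd x := by
    rw [← s.proj_lift x, vadd_proj, zero_vadd]
  add_vadd a b x := by
    rw [← s.proj_lift x, vadd_proj, vadd_proj, vadd_proj, vadd_vadd]

lemma proj_preimage_preimage_vadd (a : G) (A : Set s.Space) :
    s.proj ⁻¹' ((a +ᵥ ·) ⁻¹' A) = (a +ᵥ ·) ⁻¹' (s.proj ⁻¹' A) := by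
  ext z
  simp [vadd_proj]

end Action

variable [Countable Γ] [MeasurableConstVAdd Γ Z]

lemma measurableSet_transversal : MeasurableSet s.transversal := by
  have : s.transversal = ⋂ γ : Γ, {z | s.num z ≤ s.num (γ +ᵥ z)} := by
    ext z
    simp [transversal]
  rw [this]
  exact MeasurableSet.iInter fun γ => measurableSet_le s.measurable_num
    (s.measurable_num.comp (measurable_const_vadd γ))

instance [StandardBorelSpace Z] : StandardBorelSpace s.Space :=
  s.measurableSet_transversal.standardBorel

lemma measurableEmbedding_lift : MeasurableEmbedding s.lift :=
  MeasurableEmbedding.subtype_coe s.measurableSet_transversal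

lemma measurable_proj : Measurable s.proj := by
  intro A hA
  have : s.proj ⁻¹' A = ⋃ γ : Γ, (γ +ᵥ ·) ⁻¹' (s.lift '' A) := by
    ext z
    simp only [Set.mem_preimage, Set.mem_iUnion, Set.mem_image]
    constructor
    · intro h
      obtain ⟨γ, hγ⟩ := s.exists_vadd_eq_lift_proj z
      exact ⟨γ, _, h, hγ.symm⟩
    · rintro ⟨γ, x, hx, h⟩
      rwa [s.proj_eq_of_vadd_eq_lift h.symm]
  rw [this]
  exact MeasurableSet.iUnion fun γ =>
    measurable_const_vadd γ (s.measurableEmbedding_lift.measurableSet_image.2 hA)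

lemma measurableSet_image_proj {B : Set Z} (hB : MeasurableSet B) :
    MeasurableSet (s.proj '' B) := by
  have : s.proj '' B = ⋃ γ : Γ, s.lift ⁻¹' ((γ +ᵥ ·) ⁻¹' B) := by
    ext x
    simp only [Set.mem_image, Set.mem_iUnion, Set.mem_preimage]
    constructor
    · rintro ⟨z, hz, rfl⟩
      obtain ⟨γ, hγ⟩ := s.exists_vadd_eq_lift_proj z
      refine ⟨-γ, ?_⟩
      rwa [← hγ, neg_vadd_vadd]
    · rintro ⟨γ, h⟩
      exact ⟨_, h, by simp⟩
  rw [this]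
  exact MeasurableSet.iUnion fun γ =>
    s.measurableEmbedding_lift.measurable (measurable_const_vadd γ hB)

variable (m : Measure Z)

lemma isAddFundamentalDomain : IsAddFundamentalDomain Γ s.transversal m :=
  .mk' s.measurableSet_transversal.nullMeasurableSet s.existsUnique_vadd_mem

/-- The measure on `Z / Γ` induced by an invariant measure on `Z`. -/
noncomputable def measure : Measure s.Space := m.comap s.lift

lemma measure_apply (A : Set s.Space) : s.measure m A = m (s.proj ⁻¹' A ∩ s.transversal) := by
  rw [measure, s.measurableEmbedding_lift.comap_apply, lift_image_eq]

instance [SigmaFinite m] : SigmaFinite (s.measure m) := by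
  have h : (s.measure m).map s.lift = m.restrict (Set.range s.lift) :=
    s.measurableEmbedding_lift.map_comap m
  have : SigmaFinite ((s.measure m).map s.lift) := h ▸ inferInstance
  exact SigmaFinite.of_map _ s.measurableEmbedding_lift.measurable.aemeasurable this

instance [NullSingletonClass m] : NullSingletonClass (s.measure m) where
  measure_singleton x := by
    rw [measure, s.measurableEmbedding_lift.comap_apply, Set.image_singleton, measure_singleton]

section Invariant

variable [VAddInvariantMeasure Γ Z m]

lemma measure_eq_zero_iff {A : Set s.Space} :
    s.measure m A = 0 ↔ m (s.proj ⁻¹' A) = 0 := by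
  rw [measure_apply]
  refine ⟨fun h => (s.isAddFundamentalDomain m).measure_zero_of_invariant _ (fun γ => ?_) h,
    fun h => measure_mono_null Set.inter_subset_left h⟩
  rw [← neg_neg γ, ← Set.preimage_vadd, s.preimage_vadd_preimage_proj]

lemma measure_image_proj_le (B : Set Z) : s.measure m (s.proj '' B) ≤ m B := by
  rw [measure_apply, (s.isAddFundamentalDomain m).measure_eq_tsum B]
  refine (measure_mono ?_).trans (measure_iUnion_le fun γ : Γ => (γ +ᵥ B) ∩ s.transversal)
  rintro z ⟨⟨w, hw, hwz⟩, hz⟩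
  obtain ⟨γ, rfl⟩ := s.proj_eq_proj_iff.1 hwz
  exact Set.mem_iUnion.2 ⟨γ, Set.vadd_mem_vadd_set hw, hz⟩

end Invariant

section InvariantAction

variable {G : Type} [AddGroup G] [AddAction G Z] [VAddCommClass G Γ Z]

variable [MeasurableConstVAdd G Z]

instance : MeasurableConstVAdd G s.Space where
  measurable_const_vadd a := s.measurable_proj.comp
    ((measurable_const_vadd a).comp s.measurableEmbedding_lift.measurable)

variable [VAddInvariantMeasure Γ Z m] [VAddInvariantMeasure G Z m]

instance : VAddInvariantMeasure G s.Space (s.measure m) where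
  measure_preimage_vadd a A hA := by
    rw [measure_apply, measure_apply, proj_preimage_preimage_vadd]
    have h1 := (s.isAddFundamentalDomain m).measure_set_eq
      ((s.isAddFundamentalDomain m).vadd_of_comm (-a))
      (measurable_const_vadd a (s.measurable_proj hA)) fun γ => by
        rw [← proj_preimage_preimage_vadd, s.preimage_vadd_preimage_proj]
    rw [h1, ← Set.preimage_vadd, ← Set.preimage_inter, measure_preimage_vadd]

/-- The action on `Z / Γ` is ergodic as soon as no `Γ`-invariant set of intermediate measure in `Z`
is invariant up to null sets. -/
lemma ergodicVAdd (h : ∀ A : Set Z, MeasurableSet A → (∀ γ : Γ, (γ +ᵥ ·) ⁻¹' A = A) →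
      (∀ a : G, (a +ᵥ ·) ⁻¹' A =ᵐ[m] A) → EventuallyConst A (ae m)) :
    ErgodicVAdd G s.Space (s.measure m) where
  aeconst_of_forall_preimage_vadd_ae_eq {A} hA hinv := by
    have h1 := h (s.proj ⁻¹' A) (s.measurable_proj hA)
      (fun γ => s.preimage_vadd_preimage_proj γ A) fun a => by
        have h2 := hinv a
        rw [ae_eq_set, measure_eq_zero_iff, measure_eq_zero_iff] at h2
        rw [← s.proj_preimage_preimage_vadd, ae_eq_set]
        exact h2
    rw [eventuallyConst_set'] at h1 ⊢
    simp only [ae_eq_empty, ae_eq_univ] at h1 ⊢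
    rwa [measure_eq_zero_iff, measure_eq_zero_iff]

end InvariantAction

end OrbitNumbering

/-! ### The action defined by the stages -/

/-- The countable group `ℤ^∞` carries its discrete σ-algebra. -/
instance : MeasurableSpace ZInfty := ⊤

instance : DiscreteMeasurableSpace ZInfty := ⟨fun _ => trivial⟩

namespace Stages

variable (S : Stages)

instance (k : ℕ) : NeZero (S.N k) := S.N_pos k

/-- Sequences of digits, the compact group `∏ ℤ / N k`. -/
abbrev Digits : Type := ∀ k, Fin (S.N k)

/-- Finitely supported sequences of digits. Two elements of `S.Digits` lie in the same orbit of
this group if and only if their tails agree. -/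
abbrev FinDigits : Type := Π₀ k, Fin (S.N k)

/-- The position `-∑_{l < k} h l (ω l)` reached after the first `k` digits. -/
noncomputable def position (k : ℕ) (ω : S.Digits) : ZInfty := -∑ l ∈ Finset.range k, S.h l (ω l)

/-- The displacement between two digit sequences with the same tail. -/
noncomputable def cocycle (γ : S.FinDigits) (ω : S.Digits) : ZInfty :=
  ∑ l ∈ γ.support, (S.h l (γ l + ω l) - S.h l (ω l))

variable {S}

lemma position_succ (k : ℕ) (ω : S.Digits) :
    S.position (k + 1) ω = S.position k ω - S.h k (ω k) := by
  simp only [position, Finset.sum_range_succ]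
  abel

lemma position_mem (k : ℕ) (ω : S.Digits) : S.position k ω ∈ S.P k := by
  induction k with
  | zero => simpa [position] using S.P_zero
  | succ k ih =>
    rw [position_succ]
    exact S.P_sub k _ ih _

lemma cocycle_eq_sum {γ : S.FinDigits} {T : Finset ℕ} (hT : ∀ l ∉ T, γ l = 0) (ω : S.Digits) :
    S.cocycle γ ω = ∑ l ∈ T, (S.h l (γ l + ω l) - S.h l (ω l)) := by
  refine Finset.sum_subset (fun l hl => ?_) fun l _ hl => ?_
  · by_contra h
    exact DFinsupp.mem_support_iff.1 hl (hT l h)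
  · rw [DFinsupp.notMem_support_iff.1 hl, zero_add, sub_self]

lemma cocycle_eq_position {γ : S.FinDigits} {k : ℕ} (hγ : ∀ l, k ≤ l → γ l = 0) (ω : S.Digits) :
    S.cocycle γ ω = S.position k ω - S.position k (⇑γ + ω) := by
  rw [cocycle_eq_sum (T := Finset.range k) (fun l hl => hγ l (by simpa using hl)),
    Finset.sum_sub_distrib]
  simp only [position, Pi.add_apply]
  abel

@[simp] lemma cocycle_zero (ω : S.Digits) : S.cocycle 0 ω = 0 := by
  simp [cocycle]

lemma cocycle_add (γ γ' : S.FinDigits) (ω : S.Digits) :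
    S.cocycle (γ + γ') ω = S.cocycle γ (⇑γ' + ω) + S.cocycle γ' ω := by
  classical
  have h1 : ∀ l ∉ γ.support ∪ γ'.support, γ l = 0 ∧ γ' l = 0 := fun l hl => by
    simpa [not_or] using hl
  rw [cocycle_eq_sum (γ := γ + γ') (fun l hl => by simp [h1 l hl]),
    cocycle_eq_sum (γ := γ) (fun l hl => (h1 l hl).1),
    cocycle_eq_sum (γ := γ') (fun l hl => (h1 l hl).2), ← Finset.sum_add_distrib]
  refine Finset.sum_congr rfl fun l _ => ?_
  simp [add_assoc]

lemma exists_last {γ : S.FinDigits} {k : ℕ} (hk : γ k ≠ 0) :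
    ∃ l, k ≤ l ∧ γ l ≠ 0 ∧ ∀ j, l + 1 ≤ j → γ j = 0 := by
  have hne : γ.support.Nonempty := ⟨k, DFinsupp.mem_support_iff.2 hk⟩
  refine ⟨γ.support.max' hne, Finset.le_max' _ _ (DFinsupp.mem_support_iff.2 hk),
    DFinsupp.mem_support_iff.1 (Finset.max'_mem _ hne), fun j hj => ?_⟩
  by_contra h
  have := Finset.le_max' _ _ (DFinsupp.mem_support_iff.2 h)
  omega

lemma not_supportedBelow_cocycle {γ : S.FinDigits} {l : ℕ} (hl : γ l ≠ 0)
    (hγ : ∀ j, l + 1 ≤ j → γ j = 0) (ω : S.Digits) :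
    ¬ SupportedBelow (S.d l) (S.cocycle γ ω) := by
  intro h
  rw [cocycle_eq_position hγ, position_succ, position_succ] at h
  refine S.h_sub l ((⇑γ + ω) l) (ω l) (by simpa using hl) ?_
  have h1 := (S.P_below l _ (position_mem l ω)).sub (S.P_below l _ (position_mem l (⇑γ + ω)))
  convert h.sub h1 using 1
  abel

lemma eq_zero_of_supportedBelow_cocycle {γ : S.FinDigits} {ω : S.Digits}
    (h : SupportedBelow 1 (S.cocycle γ ω)) : γ = 0 := by
  by_contra hne
  obtain ⟨k, hk⟩ := DFunLike.ne_iff.1 hne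
  obtain ⟨l, -, hl, hγ⟩ := exists_last hk
  exact not_supportedBelow_cocycle hl hγ ω (h.mono (S.d_zero ▸ S.d_mono (Nat.zero_le l)))

noncomputable instance : AddAction S.FinDigits (S.Digits × ZInfty) where
  vadd γ z := (⇑γ + z.1, S.cocycle γ z.1 + z.2)
  zero_vadd z := Prod.ext (zero_add _) (by
    change S.cocycle 0 z.1 + z.2 = z.2
    simp)
  add_vadd γ γ' z := Prod.ext (by
    change ⇑(γ + γ') + z.1 = ⇑γ + (⇑γ' + z.1)
    rw [DFinsupp.coe_add, add_assoc]) (by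
    change S.cocycle (γ + γ') z.1 + z.2 = S.cocycle γ (⇑γ' + z.1) + (S.cocycle γ' z.1 + z.2)
    rw [cocycle_add, add_assoc])

lemma finDigits_vadd (γ : S.FinDigits) (z : S.Digits × ZInfty) :
    γ +ᵥ z = (⇑γ + z.1, S.cocycle γ z.1 + z.2) := rfl

noncomputable instance : AddAction ZInfty (S.Digits × ZInfty) where
  vadd a z := (z.1, a + z.2)
  zero_vadd _ := Prod.ext rfl (zero_add _)
  add_vadd _ _ _ := Prod.ext rfl (add_assoc _ _ _)

lemma zInfty_vadd (a : ZInfty) (z : S.Digits × ZInfty) : a +ᵥ z = (z.1, a + z.2) := rfl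

instance : VAddCommClass ZInfty S.FinDigits (S.Digits × ZInfty) where
  vadd_comm a γ z := by
    simp only [zInfty_vadd, finDigits_vadd, add_left_comm]

instance : MeasurableConstVAdd ZInfty (S.Digits × ZInfty) where
  measurable_const_vadd a := measurable_fst.prodMk
    ((Measurable.of_discrete (f := fun g : ZInfty => a + g)).comp measurable_snd)

lemma measurable_cocycle (γ : S.FinDigits) : Measurable (S.cocycle γ) := by
  have : MeasurableAdd₂ ZInfty := ⟨.of_discrete⟩
  refine Finset.measurable_sum _ fun l _ => ?_
  exact (Measurable.of_discrete (f := fun i : Fin (S.N l) => S.h l (γ l + i) - S.h l i)).comp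
    (measurable_pi_apply l)

instance : MeasurableConstVAdd S.FinDigits (S.Digits × ZInfty) where
  measurable_const_vadd γ := by
    have : MeasurableAdd₂ ZInfty := ⟨.of_discrete⟩
    exact (measurable_fst.const_add _).prodMk
      (((measurable_cocycle γ).comp measurable_fst).add measurable_snd)

variable (S)

/-- The uniform probability measure on digit sequences. -/
noncomputable def uniform : Measure S.Digits := Measure.addHaarMeasure ⊤

instance : S.uniform.IsAddHaarMeasure := by
  unfold uniform
  infer_instance

instance : IsProbabilityMeasure S.uniform where
  measure_univ := by
    exact Measure.addHaarMeasure_self (K₀ := (⊤ : TopologicalSpace.PositiveCompacts S.Digits))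

lemma uniform_cylinder (k : ℕ) (i : Fin (S.N k)) : S.N k * S.uniform {ω | ω k = i} = 1 := by
  have h1 : ∀ j, S.uniform {ω | ω k = j} = S.uniform {ω | ω k = i} := fun j => by
    rw [← measure_preimage_add S.uniform (Pi.single k (j - i)) {ω | ω k = j}]
    congr 1
    ext ω
    simp [sub_add_eq_add_sub, sub_eq_iff_eq_add]
  have h2 : (Set.univ : Set S.Digits) = ⋃ j, {ω | ω k = j} := by
    ext ω
    simp
  have h3 := measure_univ (μ := S.uniform)
  rw [h2, measure_iUnion, tsum_fintype] at h3
  · simpa [h1] using h3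
  · intro j j' hjj'
    exact Set.disjoint_left.2 fun ω h h' => hjj' (h.symm.trans h')
  · exact fun j => (measurable_pi_apply (X := fun k => Fin (S.N k)) k) (measurableSet_singleton j)

lemma card_P_pos (k : ℕ) : 0 < (S.P k).card :=
  Finset.card_pos.2 ⟨_, position_mem k 0⟩

instance : NullSingletonClass S.uniform where
  measure_singleton ω := by
    by_contra hne
    obtain ⟨k, hk⟩ := ENNReal.exists_nat_mul_gt hne ENNReal.one_ne_top
    refine absurd hk (not_lt.2 ?_)
    rw [← S.uniform_cylinder k (ω k)]
    have h1 : k ≤ S.N k := calc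
      k ≤ 4 ^ k * 1 := by
        rw [mul_one]
        exact (Nat.lt_pow_self (by norm_num)).le
      _ ≤ _ := (Nat.mul_le_mul_left _ (S.card_P_pos k)).trans (S.card_le k)
    gcongr
    rintro _ rfl
    rfl

/-- The measure on the product of digit sequences and positions. -/
noncomputable def prodMeasure : Measure (S.Digits × ZInfty) := S.uniform.prod Measure.count

instance : SigmaFinite S.prodMeasure := by
  unfold prodMeasure
  infer_instance

instance : NullSingletonClass S.prodMeasure := by
  unfold prodMeasure
  infer_instance

instance : VAddInvariantMeasure ZInfty (S.Digits × ZInfty) S.prodMeasure where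
  measure_preimage_vadd a A hA := by
    have h : MeasurePreserving (fun z : S.Digits × ZInfty => (z.1, a + z.2))
        S.prodMeasure S.prodMeasure :=
      (MeasurePreserving.id _).prod (measurePreserving_add_left Measure.count a)
    exact h.measure_preimage hA.nullMeasurableSet

instance : VAddInvariantMeasure S.FinDigits (S.Digits × ZInfty) S.prodMeasure where
  measure_preimage_vadd γ A hA := by
    have : MeasurableAdd₂ ZInfty := ⟨.of_discrete⟩
    have h : MeasurePreserving (fun z : S.Digits × ZInfty => (⇑γ + z.1, S.cocycle γ z.1 + z.2))
        S.prodMeasure S.prodMeasure :=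
      (measurePreserving_add_left S.uniform ⇑γ).skew_product
        (((measurable_cocycle γ).comp measurable_fst).add measurable_snd)
        (ae_of_all _ fun ω => (measurePreserving_add_left Measure.count (S.cocycle γ ω)).map_eq)
    exact h.measure_preimage hA.nullMeasurableSet

lemma denseRange_finDigits : DenseRange (fun γ : S.FinDigits => (⇑γ : S.Digits)) := by
  intro ω
  refine mem_closure_of_tendsto (b := atTop)
    (f := fun n : ℕ => ⇑(DFinsupp.mk (Finset.range n) fun l => ω l : S.FinDigits))
    (tendsto_pi_nhds.2 fun k => ?_) (Eventually.of_forall fun n => ⟨_, rfl⟩)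
  refine tendsto_const_nhds.congr' ?_
  filter_upwards [eventually_gt_atTop k] with n hn
  simp [DFinsupp.mk_apply, hn]

/-- A set of digit sequences which is invariant, up to null sets, under every finite change of
digits is null or conull. -/
lemma eventuallyConst_of_finDigits {B : Set S.Digits} (hB : MeasurableSet B)
    (h : ∀ γ : S.FinDigits, (⇑γ + ·) ⁻¹' B =ᵐ[S.uniform] B) :
    EventuallyConst B (ae S.uniform) := by
  refine aeconst_of_dense_setOfPred_preimage_vadd_ae (M := S.Digits) hB.nullMeasurableSet
    (S.denseRange_finDigits.mono ?_)
  rintro _ ⟨γ, rfl⟩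
  exact h γ

lemma eventuallyConst_of_invariant {A : Set (S.Digits × ZInfty)} (hA : MeasurableSet A)
    (hΓ : ∀ γ : S.FinDigits, (γ +ᵥ ·) ⁻¹' A = A)
    (hG : ∀ a : ZInfty, (a +ᵥ ·) ⁻¹' A =ᵐ[S.prodMeasure] A) :
    EventuallyConst A (ae S.prodMeasure) := by
  have h1 : ∀ᵐ ω ∂S.uniform, ∀ a : ZInfty, (ω, a) ∈ A ↔ (ω, 0) ∈ A := by
    rw [ae_all_iff]
    intro a
    have h2 := Measure.ae_ae_of_ae_prod (eventuallyEq_set.1 (hG a))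
    filter_upwards [h2] with ω hω
    simpa [zInfty_vadd] using Measure.ae_count_iff.1 hω 0
  have hB : MeasurableSet {ω : S.Digits | (ω, (0 : ZInfty)) ∈ A} := measurable_prodMk_right hA
  have h2 := S.eventuallyConst_of_finDigits hB fun γ => by
    rw [eventuallyEq_set]
    filter_upwards [(measurePreserving_add_left S.uniform ⇑γ).quasiMeasurePreserving.ae h1]
      with ω hω
    have h3 : γ +ᵥ (ω, (0 : ZInfty)) ∈ A ↔ (ω, (0 : ZInfty)) ∈ A := by
      rw [← Set.mem_preimage (f := (γ +ᵥ ·)), hΓ γ]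
    rw [finDigits_vadd] at h3
    exact (hω _).symm.trans h3
  rw [eventuallyConst_set] at h2 ⊢
  have h4 : ∀ᵐ z ∂S.prodMeasure, z ∈ A ↔ (z.1, (0 : ZInfty)) ∈ A := by
    have := Measure.quasiMeasurePreserving_fst (μ := S.uniform)
      (ν := (Measure.count : Measure ZInfty)) |>.ae h1
    filter_upwards [this] with z hz using hz z.2
  have hq : Measure.QuasiMeasurePreserving Prod.fst S.prodMeasure S.uniform :=
    Measure.quasiMeasurePreserving_fst
  refine h2.imp (fun h => ?_) fun h => ?_
  · filter_upwards [h4, hq.ae h] with z hz hz' using hz.2 hz'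
  · filter_upwards [h4, hq.ae h] with z hz hz' using fun hmem => hz' (hz.1 hmem)

/-- Numbering by position separates the points of an orbit. -/
noncomputable def numbering : OrbitNumbering S.FinDigits (S.Digits × ZInfty) where
  num z := Encodable.encode z.2
  measurable_num := (Measurable.of_discrete (f := fun g : ZInfty => Encodable.encode g)).comp
    measurable_snd
  eq_zero_of_num_eq γ z h := by
    have h1 := Encodable.encode_injective h
    rw [finDigits_vadd] at h1
    have h2 : S.cocycle γ z.1 = 0 := by simpa using h1
    exact eq_zero_of_supportedBelow_cocycle (h2 ▸ SupportedBelow.zero 1)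

/-- The space carrying the action of `ℤ^∞` defined by the stages. -/
abbrev Space : Type := S.numbering.Space

/-- The invariant measure on `S.Space`. -/
noncomputable abbrev measure : Measure S.Space := S.numbering.measure S.prodMeasure

instance : ErgodicVAdd ZInfty S.Space S.measure :=
  S.numbering.ergodicVAdd S.prodMeasure fun _ hA hΓ hG => S.eventuallyConst_of_invariant hA hΓ hG

/-- The copy of the space of digit sequences sitting at position `a`. -/
def base (a : ZInfty) : Set S.Space := S.numbering.proj '' {z | z.2 = a}

/-- The part of the base at position `h k 0` where the digit `k` vanishes. -/
def target (k : ℕ) : Set S.Space := S.numbering.proj '' {z | z.1 k = 0 ∧ z.2 = S.h k 0}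

lemma measurableSet_base (a : ZInfty) : MeasurableSet (S.base a) :=
  S.numbering.measurableSet_image_proj (measurable_snd (measurableSet_singleton a))

lemma measurableSet_target (k : ℕ) : MeasurableSet (S.target k) :=
  S.numbering.measurableSet_image_proj
    ((((measurable_pi_apply k).comp measurable_fst) (measurableSet_singleton 0)).inter
      (measurable_snd (measurableSet_singleton _)))

variable {S}

lemma proj_mem_base {a : ZInfty} {z : S.Digits × ZInfty} :
    S.numbering.proj z ∈ S.base a ↔ ∃ γ : S.FinDigits, S.cocycle γ z.1 + z.2 = a := by
  constructor
  · rintro ⟨w, hw, hwz⟩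
    obtain ⟨γ, rfl⟩ := S.numbering.proj_eq_proj_iff.1 hwz.symm
    exact ⟨γ, hw⟩
  · rintro ⟨γ, h⟩
    exact ⟨γ +ᵥ z, h, by simp⟩

/-- Moving by `h k (ω k)` from the base at `0` leads to `target k`. -/
lemma proj_mem_target (k : ℕ) (ω : S.Digits) :
    S.numbering.proj (ω, S.h k (ω k)) ∈ S.target k := by
  refine ⟨(DFinsupp.single k (-ω k) : S.FinDigits) +ᵥ (ω, S.h k (ω k)), ⟨?_, ?_⟩, by simp⟩
  · simp [finDigits_vadd]
  · rw [finDigits_vadd, cocycle_eq_sum (T := {k}) fun l hl => ?_]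
    · simp
    · exact DFinsupp.single_eq_of_ne (by simpa using hl)

variable (S)

lemma measure_base_le (a : ZInfty) : S.measure (S.base a) ≤ 1 := by
  refine (S.numbering.measure_image_proj_le S.prodMeasure _).trans_eq ?_
  have : {z : S.Digits × ZInfty | z.2 = a} = Set.univ ×ˢ {a} := by
    ext z
    simp
  rw [this, prodMeasure, Measure.prod_prod]
  simp

lemma measure_base_ne_zero (a : ZInfty) : S.measure (S.base a) ≠ 0 := by
  rw [Ne, S.numbering.measure_eq_zero_iff]
  intro h
  have h1 : (Set.univ : Set S.Digits) ×ˢ {a} ⊆ S.numbering.proj ⁻¹' S.base a := by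
    rintro z ⟨-, hz⟩
    exact ⟨z, hz, rfl⟩
  have h2 := measure_mono_null h1 h
  rw [prodMeasure, Measure.prod_prod] at h2
  simp at h2

lemma measure_target_le (k : ℕ) : S.N k * S.measure (S.target k) ≤ 1 := by
  rw [← S.uniform_cylinder k 0]
  gcongr
  refine (S.numbering.measure_image_proj_le S.prodMeasure _).trans_eq ?_
  have : {z : S.Digits × ZInfty | z.1 k = 0 ∧ z.2 = S.h k 0} = {ω | ω k = 0} ×ˢ {S.h k 0} := by
    ext z
    simp
  rw [this, prodMeasure, Measure.prod_prod]
  simp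

lemma preimage_vadd_base (a b : ZInfty) : (a +ᵥ ·) ⁻¹' S.base (a + b) = S.base b := by
  ext x
  obtain ⟨z, rfl⟩ : ∃ z, S.numbering.proj z = x := ⟨_, S.numbering.proj_lift x⟩
  rw [Set.mem_preimage, S.numbering.vadd_proj, proj_mem_base, proj_mem_base]
  simp [zInfty_vadd, add_left_comm]

lemma disjoint_base {i j : ℤ} (hij : i ≠ j) :
    Disjoint (S.base (Finsupp.single 0 i)) (S.base (Finsupp.single 0 j)) := by
  rw [Set.disjoint_left]
  rintro _ ⟨z, hz, rfl⟩ hx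
  obtain ⟨γ, hγ⟩ := proj_mem_base.1 hx
  rw [show z.2 = Finsupp.single 0 i from hz] at hγ
  have h1 : S.cocycle γ z.1 = Finsupp.single 0 (j - i) := by
    rw [Finsupp.single_sub, ← hγ, add_sub_cancel_right]
  have h2 : γ = 0 := eq_zero_of_supportedBelow_cocycle (ω := z.1) fun m hm => by
    rw [h1, Finsupp.single_eq_of_ne (by omega)]
  rw [h2, cocycle_zero, zero_add] at hγ
  exact hij (Finsupp.single_injective 0 hγ)

lemma measure_univ_eq_top : S.measure Set.univ = ⊤ := by
  have h1 : ∀ a, S.measure (S.base a) = S.measure (S.base 0) := fun a => by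
    rw [← S.preimage_vadd_base a 0, measure_preimage_vadd, add_zero]
  have h2 : S.measure (⋃ i : ℤ, S.base (Finsupp.single 0 i)) = ⊤ := by
    rw [measure_iUnion (fun i j hij => S.disjoint_base hij) fun i => S.measurableSet_base _]
    simp only [h1]
    exact ENNReal.tsum_const_eq_top_of_ne_zero (S.measure_base_ne_zero 0)
  exact top_unique (h2 ▸ measure_mono (Set.subset_univ _))

end Stages

/-! ### Failure of the ratio ergodic theorem -/

namespace Stages

variable {S : Stages} {F : ℕ → Finset ZInfty} {n : ∀ k, Fin (S.N k) → ℕ}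

/-- If an element of `F (n k (ω k))` returns the digit sequence `ω` to the base, then only the
digits before stage `k` change: a change at stage `k` is excluded by the separation of the vectors
`h k i`, and one at a later stage leads out of the span of `F (n k (ω k))`. -/
lemma Adapted.eq_zero_of_return (hS : S.Adapted F n) {k : ℕ} {ω : S.Digits} {g : ZInfty}
    (hg : g ∈ F (n k (ω k))) {γ : S.FinDigits} (hγ : S.cocycle γ ω + g = 0) (j : ℕ)
    (hj : k ≤ j) : γ j = 0 := by
  by_contra hne
  obtain ⟨l, hjl, hl, hlast⟩ := exists_last hne
  rcases (hj.trans hjl).eq_or_lt with rfl | hkl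
  · rw [cocycle_eq_position hlast, position_succ, position_succ] at hγ
    refine hS.notMem k (ω k) ((⇑γ + ω) k) (by simpa using hl) _ (position_mem k ω) _
      (position_mem k (⇑γ + ω)) ?_
    convert hg using 1
    rw [← sub_eq_zero, ← neg_eq_zero, ← hγ]
    abel
  · refine not_supportedBelow_cocycle hl hlast ω ?_
    rw [eq_neg_of_add_eq_zero_left hγ, ← zero_sub]
    exact (SupportedBelow.zero _).sub ((hS.below k (ω k) g hg).mono (S.d_mono hkl))

lemma Adapted.ergodicSum_base_le (hS : S.Adapted F n) (k : ℕ) (ω : S.Digits) :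
    ergodicSum (F (n k (ω k))) ((S.base 0).indicator 1) (S.numbering.proj (ω, 0)) ≤
      (S.P k).card := by
  classical
  have h1 : ∀ g : ZInfty, (S.base 0).indicator (1 : S.Space → ℝ) (g +ᵥ S.numbering.proj (ω, 0)) =
      if g +ᵥ S.numbering.proj (ω, 0) ∈ S.base 0 then 1 else 0 := fun g => by
    simp [Set.indicator_apply]
  simp only [ergodicSum, h1, Finset.sum_boole]
  norm_cast
  refine (Finset.card_le_card fun g hg => ?_).trans
    (Finset.card_image_le (s := S.P k) (f := fun p => p - S.position k ω))
  rw [Finset.mem_filter, S.numbering.vadd_proj, proj_mem_base] at hg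
  obtain ⟨hg, γ, hγ⟩ := hg
  simp only [zInfty_vadd, add_zero] at hγ
  rw [cocycle_eq_position (hS.eq_zero_of_return hg hγ)] at hγ
  refine Finset.mem_image.2 ⟨_, position_mem k (⇑γ + ω), ?_⟩
  rw [← sub_eq_zero, ← neg_eq_zero, ← hγ]
  abel

variable (S)

/-- The numerator of the ratios, before passing to real values: at stage `k`, a weight of total
mass at most `2⁻ᵏ` is put on `target k`. -/
noncomputable def spikes (x : S.Space) : ENNReal :=
  ∑' k, (S.target k).indicator (fun _ => 2 ^ k * ((S.P k).card : ENNReal)) x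

lemma measurable_spikes : Measurable S.spikes :=
  Measurable.tsum fun k => measurable_const.indicator (S.measurableSet_target k)

lemma lintegral_spikes_ne_top : ∫⁻ x, S.spikes x ∂S.measure ≠ ⊤ := by
  unfold spikes
  rw [lintegral_tsum fun k =>
    (measurable_const.indicator (S.measurableSet_target k)).aemeasurable]
  refine ne_top_of_le_ne_top (b := ∑' k : ℕ, (2⁻¹ : ENNReal) ^ k) ?_
    (ENNReal.tsum_le_tsum fun k => ?_)
  · rw [ENNReal.tsum_geometric, ENNReal.one_sub_inv_two, inv_inv]
    exact ENNReal.ofNat_ne_top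
  · rw [lintegral_indicator_const (S.measurableSet_target k)]
    have h2 : (2 : ENNReal) ^ k ≠ 0 := pow_ne_zero _ two_ne_zero
    have h2' : (2 : ENNReal) ^ k ≠ ⊤ := ENNReal.pow_ne_top ENNReal.ofNat_ne_top
    rw [ENNReal.inv_pow.symm, ← one_div, ENNReal.le_div_iff_mul_le (.inl h2) (.inl h2')]
    calc 2 ^ k * ((S.P k).card : ENNReal) * S.measure (S.target k) * 2 ^ k
        = ((4 ^ k * (S.P k).card : ℕ) : ENNReal) * S.measure (S.target k) := by
          have : (4 : ENNReal) ^ k = 2 ^ k * 2 ^ k := by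
            rw [← mul_pow]
            norm_num
          push_cast
          rw [this]
          ring
      _ ≤ S.N k * S.measure (S.target k) := by
          gcongr
          exact S.card_le k
      _ ≤ 1 := S.measure_target_le k

lemma ae_spikes_ne_top : ∀ᵐ x ∂S.measure, ∀ a : ZInfty, S.spikes (a +ᵥ x) ≠ ⊤ := by
  rw [ae_all_iff]
  intro a
  exact (measurePreserving_vadd a S.measure).quasiMeasurePreserving.ae
    ((ae_lt_top S.measurable_spikes S.lintegral_spikes_ne_top).mono fun _ h => h.ne)

lemma le_spikes {k : ℕ} {x : S.Space} (hx : x ∈ S.target k) :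
    2 ^ k * ((S.P k).card : ENNReal) ≤ S.spikes x := by
  have h : (S.target k).indicator (fun _ => 2 ^ k * ((S.P k).card : ENNReal)) x ≤ S.spikes x :=
    ENNReal.le_tsum k
  rwa [Set.indicator_of_mem hx] at h

lemma integrable_base (a : ZInfty) :
    Integrable ((S.base a).indicator (1 : S.Space → ℝ)) S.measure :=
  (integrable_indicator_iff (S.measurableSet_base a)).2
    (integrableOn_const (ne_top_of_le_ne_top ENNReal.one_ne_top (S.measure_base_le a)))

lemma integral_base_ne_zero (a : ZInfty) :
    ∫ x, (S.base a).indicator (1 : S.Space → ℝ) x ∂S.measure ≠ 0 := by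
  rw [integral_indicator_one (S.measurableSet_base a)]
  exact (measureReal_ne_zero_iff
    (ne_top_of_le_ne_top ENNReal.one_ne_top (S.measure_base_le a))).2 (S.measure_base_ne_zero a)

variable {S}

lemma Adapted.le_ergodicSum_spikes (hS : S.Adapted F n) (k : ℕ) (ω : S.Digits)
    (hfin : ∀ a : ZInfty, S.spikes (a +ᵥ S.numbering.proj (ω, 0)) ≠ ⊤) :
    2 ^ k * ((S.P k).card : ℝ) ≤
      ergodicSum (F (n k (ω k))) (fun x => (S.spikes x).toReal) (S.numbering.proj (ω, 0)) := by
  have h1 : S.h k (ω k) +ᵥ S.numbering.proj (ω, 0) ∈ S.target k := by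
    rw [S.numbering.vadd_proj, zInfty_vadd, add_zero]
    exact proj_mem_target k ω
  calc 2 ^ k * ((S.P k).card : ℝ) = (2 ^ k * ((S.P k).card : ENNReal)).toReal := by simp
    _ ≤ (S.spikes (S.h k (ω k) +ᵥ S.numbering.proj (ω, 0))).toReal :=
        ENNReal.toReal_mono (hfin _) (S.le_spikes h1)
    _ ≤ _ := Finset.single_le_sum
        (f := fun g => (S.spikes (g +ᵥ S.numbering.proj (ω, 0))).toReal)
        (fun _ _ => ENNReal.toReal_nonneg) (hS.mem k (ω k))

lemma Adapted.not_ratioErgodicTheoremAlong (hS : S.Adapted F n) :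
    ¬ RatioErgodicTheoremAlong F := by
  intro h
  have h1 := h S.Space S.measure S.measure_univ_eq_top (fun x => (S.spikes x).toReal)
    ((S.base 0).indicator 1)
    (integrable_toReal_of_lintegral_ne_top S.measurable_spikes.aemeasurable
      S.lintegral_spikes_ne_top) (S.integrable_base 0) (S.integral_base_ne_zero 0)
  have h2 := h S.Space S.measure S.measure_univ_eq_top ((S.base 0).indicator 1)
    ((S.base 0).indicator 1) (S.integrable_base 0) (S.integrable_base 0)
    (S.integral_base_ne_zero 0)
  obtain ⟨x, hx, ⟨h1, h2⟩, h3⟩ := ((frequently_ae_mem_iff.2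
    (S.measure_base_ne_zero 0)).and_eventually ((h1.and h2).and S.ae_spikes_ne_top)).exists
  obtain ⟨⟨ω, a⟩, rfl, rfl⟩ := hx
  generalize (∫ y, (S.spikes y).toReal ∂S.measure) / _ = c at h1
  rw [div_self (S.integral_base_ne_zero 0)] at h2
  obtain ⟨n₀, hn₀⟩ := eventually_atTop.1
    ((h1.eventually_lt_const (lt_add_one c)).and (h2.eventually_ne one_ne_zero))
  obtain ⟨k₁, hk₁⟩ := pow_unbounded_of_one_lt (c + 1) (one_lt_two : (1 : ℝ) < 2)
  let k := max n₀ k₁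
  obtain ⟨h4, h5⟩ := hn₀ (n k (ω k)) ((le_max_left _ _).trans (hS.le k (ω k)))
  -- The ratio of the base to itself is not `0`, so the denominator does not vanish.
  have h6 : ergodicSum (F (n k (ω k))) ((S.base 0).indicator 1) (S.numbering.proj (ω, 0)) ≠ 0 :=
    fun h0 => h5 (by rw [ergodicRatio, h0, div_zero])
  have h7 : 0 < ergodicSum (F (n k (ω k))) ((S.base 0).indicator 1)
      (S.numbering.proj (ω, 0)) := lt_of_le_of_ne
    (Finset.sum_nonneg fun _ _ => Set.indicator_nonneg (fun _ _ => zero_le_one) _) h6.symm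
  rw [ergodicRatio, div_lt_iff₀ h7] at h4
  have h8 := hS.le_ergodicSum_spikes k ω h3
  have h9 := hS.ergodicSum_base_le k ω
  have h10 : c + 1 < 2 ^ k := hk₁.trans_le (pow_le_pow_right₀ one_le_two (le_max_right _ _))
  have h11 : (2 : ℝ) ^ k * ergodicSum (F (n k (ω k))) ((S.base 0).indicator 1)
      (S.numbering.proj (ω, 0)) ≤ 2 ^ k * (S.P k).card := by gcongr
  nlinarith

end Stages

/-- If the ratio ergodic theorem holds along subsets `F n` of a group, then it holds along their
images (with multiplicity) in every quotient. -/
lemma RatioErgodicTheoremAlong.comp {G H : Type*} [AddGroup G] [AddGroup H]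
    {F : ℕ → Finset G} (h : RatioErgodicTheoremAlong F) (σ : G →+ H) (hσ : Function.Surjective σ)
    (X : Type) [MeasurableSpace X] [StandardBorelSpace X] [AddAction H X] [MeasurableConstVAdd H X]
    (μ : Measure X) [SigmaFinite μ] [NullSingletonClass μ] [ErgodicVAdd H X μ]
    (hμ : μ Set.univ = ⊤) (φ ψ : X → ℝ) (hφ : Integrable φ μ) (hψ : Integrable ψ μ)
    (hψ0 : ∫ x, ψ x ∂μ ≠ 0) :
    ∀ᵐ x ∂μ, Tendsto
      (fun n => (∑ g ∈ F n, φ (σ g +ᵥ x)) / ∑ g ∈ F n, ψ (σ g +ᵥ x)) atTop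
        (𝓝 ((∫ y, φ y ∂μ) / ∫ y, ψ y ∂μ)) := by
  let _ : AddAction G X := AddAction.compHom X σ
  have : MeasurableConstVAdd G X := ⟨fun g => measurable_const_vadd (σ g)⟩
  have : ErgodicVAdd G X μ :=
    { measure_preimage_vadd := fun g _ hs => measure_preimage_vadd_of_nullMeasurableSet
        hs.nullMeasurableSet (σ g)
      aeconst_of_forall_preimage_vadd_ae_eq := fun hs hinv =>
        ErgodicVAdd.aeconst_of_forall_preimage_vadd_ae_eq (G := H) hs fun a => by
          obtain ⟨g, rfl⟩ := hσ a
          exact hinv g }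
  exact h X μ hμ φ ψ hφ hψ hψ0

/-- If all `F n` with `n` large lie in a fixed subgroup `ℤ^d`, then the ratio ergodic theorem fails
for an action in which this subgroup acts trivially. -/
lemma not_ratioErgodicTheoremAlong_of_supportedBelow {F : ℕ → Finset ZInfty} {d n₀ : ℕ}
    (hF : ∀ n, n₀ ≤ n → ∀ g ∈ F n, SupportedBelow d g) : ¬ RatioErgodicTheoremAlong F := by
  intro h
  -- Any escaping sequence of finite sets yields an ergodic action to pull back.
  have hesc : Escaping fun n => {Finsupp.single n 1} := fun d n₀ =>
    ⟨max d n₀, le_max_right _ _, _, Finset.mem_singleton_self _, fun hs => by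
      simpa using hs _ (le_max_left d n₀)⟩
  obtain ⟨S, -, -⟩ := hesc.exists_stages
  let σ : ZInfty →+ ZInfty := Finsupp.comapDomain.addMonoidHom (add_left_injective d)
  have hσ : Function.Surjective σ := fun g =>
    ⟨g.mapDomain (· + d), Finsupp.comapDomain_mapDomain _ (add_left_injective d) g⟩
  have h1 := h.comp σ hσ S.Space S.measure S.measure_univ_eq_top
    ((S.base (Finsupp.single 0 1)).indicator 1) ((S.base (Finsupp.single 0 0)).indicator 1)
    (S.integrable_base _) (S.integrable_base _) (S.integral_base_ne_zero _)
  obtain ⟨x, hx, h2⟩ := ((frequently_ae_mem_iff.2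
    (S.measure_base_ne_zero (Finsupp.single 0 0))).and_eventually h1).exists
  have hx' : x ∉ S.base (Finsupp.single 0 1) :=
    Set.disjoint_left.1 (S.disjoint_base zero_ne_one) hx
  refine div_ne_zero (S.integral_base_ne_zero (Finsupp.single 0 1))
    (S.integral_base_ne_zero (Finsupp.single 0 0)) (tendsto_nhds_unique h2 ?_)
  refine tendsto_const_nhds.congr' ?_
  filter_upwards [eventually_ge_atTop n₀] with n hn
  rw [Finset.sum_eq_zero (s := F n), zero_div]
  intro g hg
  have h3 : σ g = 0 := Finsupp.ext fun m => hF n hn g hg (m + d) (Nat.le_add_left d m)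
  rw [h3, zero_vadd, Set.indicator_of_notMem hx']

theorem theorem1p2 (F : ℕ → Finset ZInfty) : ¬ RatioErgodicTheoremAlong F := by
  by_cases hF : Escaping F
  · obtain ⟨S, n, hS⟩ := hF.exists_stages
    exact hS.not_ratioErgodicTheoremAlong
  · simp only [Escaping, not_forall, not_exists, not_and, not_not] at hF
    obtain ⟨d, n₀, hF⟩ := hF
    exact not_ratioErgodicTheoremAlong_of_supportedBelow hF
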